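/- Let $(X,\operatorname{dist})$ be a compact metric space and let $f\colon X\to X$ be a homeomorphism. Suppose that $f$ is \emph{recurrent}: for every $\varepsilon>0$ there is $n\in\mathbb{Z}$, $n\neq 0$, such that $\operatorname{dist}(x,f^n(x))<\varepsilon$ for all $x\in X$. Suppose also that $f$ satisfies at least one of the following two conditions. 1. $f$ is \emph{finite expansive}: there is $\eta>0$ such that for every $x\in X$ the set $\Gamma_\eta(x)=\{y\in X:\operatorname{dist}(f^k(x),f^k(y))\leq\eta\text{ for all }k\in\mathbb{Z}\}$ is finite. 2. $f$ is \emph{separating}: there is $\eta>0$ such that for all $x,y\in X$ with $y\notin\{f^n(x):n\in\mathbb{Z}\}$ there is $n\in\mathbb{Z}$ with $\operatorname{dist}(f^n(x),f^n(y))>\eta$. Then $X$ is a finite set. -/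

import Mathlib

namespace TopDyn

/-- The orbit `O(x) = {f ^ n (x) : n ∈ ℤ}`. The power `f ^ n` is the `n`-th iterate, taken in the
group of self-homeomorphisms of `X`. -/
def orbit {X : Type*} [TopologicalSpace X] (f : X ≃ₜ X) (x : X) : Set X :=
  {y | ∃ n : ℤ, y = (f ^ n) x}

/-- The dynamical ball
`Γ_η(x) = {y ∈ X : dist (f ^ k (x)) (f ^ k (y)) ≤ η for all k ∈ ℤ}`. -/
def dynBall {X : Type*} [MetricSpace X] (f : X ≃ₜ X) (η : ℝ) (x : X) : Set X :=
  {y | ∀ k : ℤ, dist ((f ^ k) x) ((f ^ k) y) ≤ η}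

/-- `f` is finite expansive: for some `η > 0`, every dynamical ball `Γ_η(x)` is finite. -/
def FiniteExpansive {X : Type*} [MetricSpace X] (f : X ≃ₜ X) : Prop :=
  ∃ η : ℝ, 0 < η ∧ ∀ x : X, (dynBall f η x).Finite

/-- `f` is separating: for some `η > 0`, points of distinct orbits are at distance `> η` at
some time. -/
def Separating {X : Type*} [MetricSpace X] (f : X ≃ₜ X) : Prop :=
  ∃ η : ℝ, 0 < η ∧ ∀ x y : X, y ∉ orbit f x → ∃ n : ℤ, η < dist ((f ^ n) x) ((f ^ n) y)

/-- `f` is recurrent: for every `ε > 0` some nonzero power of `f` moves every point by less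
than `ε`. -/
def Recurrent {X : Type*} [MetricSpace X] (f : X ≃ₜ X) : Prop :=
  ∀ ε : ℝ, 0 < ε → ∃ n : ℤ, n ≠ 0 ∧ ∀ x : X, dist x ((f ^ n) x) < ε

end TopDyn

/-!
Both conditions make all dynamical balls `Γ_η(x)` of some radius `η > 0` countable, and for a
recurrent `f` this already forces every point to be periodic (`exists_zpow_apply_eq_self`). Indeed,
let `T` be the set of the points `f ^ n (x)` for those `n` such that `f ^ n` is uniformly within
some `r < η` of the identity. As powers of `f` commute, `T ⊆ Γ_η(x)`, so the closure of `T` is a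
countable compact set, and by Baire's theorem it has an isolated point `z`, which lies in `T`. If
`f ^ m` is close enough to the identity, then `f ^ m (z)` belongs to `T` as well and is close to
`z`; hence `f ^ m (z) = z`, and `x`, being on the orbit of `z`, is periodic.

Once all points are periodic, all orbits are finite, so a separating `f` is finite expansive. It
remains to see that a finite expansive, pointwise periodic homeomorphism lives on a discrete space
(`isOpen_singleton_of_periodic`). If `x` were not isolated, then for every `δ ≤ η` the points
`y ≠ x` near `x` are outside `Γ_δ(x)`; following the orbits of `x` and `y` until the first time at
which they are more than `δ` apart, and letting `y → x`, one finds in the limit points `x'` on the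
orbit of `x` and `z` with `dist (x', z) ≥ δ`, whose backward iterates stay within `δ`. By
periodicity `z ∈ Γ_δ(x')`, so that `dist (x', z) = δ`. But only finitely many values
`dist (x', z)` arise from `x'` on the finite orbit of `x` and `z ∈ Γ_η(x')`, whereas `δ ∈ (0, η]`
is arbitrary.
-/

/-! ### Powers and orbits -/

namespace TopDyn

open Filter Topology Set

section Periodic

variable {X : Type*} [TopologicalSpace X] (f : X ≃ₜ X)

theorem zpow_add_apply (m n : ℤ) (x : X) : (f ^ (m + n)) x = (f ^ m) ((f ^ n) x) := by
  rw [zpow_add]; rfl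

theorem continuous_zpow (n : ℤ) : Continuous fun x => (f ^ n) x :=
  (f ^ n).continuous

variable {f}

theorem periodic_zpow_apply {x : X} {n : ℤ} (h : (f ^ n) x = x) :
    Function.Periodic (fun k : ℤ => (f ^ k) x) n := fun k => by
  simp only [zpow_add_apply, h]

theorem exists_pos_periodic_zpow_apply {x : X} (h : ∃ n : ℤ, n ≠ 0 ∧ (f ^ n) x = x) :
    ∃ n : ℤ, 0 < n ∧ Function.Periodic (fun k : ℤ => (f ^ k) x) n := by
  obtain ⟨n, hn, hx⟩ := h
  rcases lt_or_gt_of_ne hn with h | h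
  · exact ⟨-n, by omega, (periodic_zpow_apply hx).neg⟩
  · exact ⟨n, h, periodic_zpow_apply hx⟩

theorem finite_orbit {x : X} (h : ∃ n : ℤ, n ≠ 0 ∧ (f ^ n) x = x) : (orbit f x).Finite := by
  obtain ⟨n, hn, hp⟩ := exists_pos_periodic_zpow_apply h
  refine ((finite_Ico (0 : ℤ) n).image fun k => (f ^ k) x).subset ?_
  rintro _ ⟨k, rfl⟩
  obtain ⟨j, hj, e⟩ := hp.exists_mem_Ico₀ hn k
  exact ⟨j, hj, e.symm⟩

theorem countable_orbit (f : X ≃ₜ X) (x : X) : (orbit f x).Countable :=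
  (countable_range fun n : ℤ => (f ^ n) x).mono (by rintro _ ⟨n, rfl⟩; exact ⟨n, rfl⟩)

end Periodic

/-! ### Isolated points of countable compact sets -/

/-- Baire's theorem, applied to the cover of the closure of `T` by its points. A point isolated in
the closure of `T` belongs to `T` itself. -/
theorem exists_isOpen_inter_closure_eq_singleton {X : Type*} [TopologicalSpace X] [CompactSpace X]
    [T2Space X] {T : Set X} (hne : T.Nonempty) (hT : (closure T).Countable) :
    ∃ z ∈ T, ∃ U : Set X, IsOpen U ∧ U ∩ closure T = {z} := by
  have : CompactSpace (closure T) := isCompact_iff_compactSpace.1 isClosed_closure.isCompact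
  have : Countable (closure T) := hT.to_subtype
  have : Nonempty (closure T) := hne.closure.to_subtype
  obtain ⟨z, hz⟩ := nonempty_interior_of_iUnion_of_closed
    (fun w : closure T => isClosed_singleton (x := w)) (iUnion_of_singleton _)
  have ho : IsOpen ({z} : Set (closure T)) :=
    interior_eq_iff_isOpen.1
      ((subset_singleton_iff_eq.1 interior_subset).resolve_left hz.ne_empty)
  obtain ⟨U, hU, e⟩ := isOpen_induced_iff.1 ho
  have hUT : U ∩ closure T = {(z : X)} := by
    rw [inter_comm, ← Subtype.image_preimage_coe, e, image_singleton]
  have hzU : (z : X) ∈ U := (hUT.ge rfl).1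
  obtain ⟨w, hwU, hwT⟩ := mem_closure_iff.1 z.2 U hU hzU
  have hwz : w = z := hUT.le ⟨hwU, subset_closure hwT⟩
  exact ⟨z, hwz ▸ hwT, U, hU, hUT⟩

/-! ### Recurrence and periodic points -/

section Metric

variable {X : Type*} [MetricSpace X] {f : X ≃ₜ X} {η : ℝ} {x : X}

theorem isClosed_dynBall (f : X ≃ₜ X) (η : ℝ) (x : X) : IsClosed (dynBall f η x) := by
  simp only [dynBall, ofPred_forall]
  exact isClosed_iInter fun k =>
    isClosed_le (continuous_const.dist (continuous_zpow f k)) continuous_const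

theorem dynBall_mono {δ : ℝ} (h : δ ≤ η) : dynBall f δ x ⊆ dynBall f η x :=
  fun _ hy k => (hy k).trans h

theorem zpow_apply_mem_dynBall {n : ℤ} (h : ∀ z, dist z ((f ^ n) z) ≤ η) :
    (f ^ n) x ∈ dynBall f η x := fun k => by
  rw [← zpow_add_apply, add_comm, zpow_add_apply]
  exact h _

/-- A recurrent homeomorphism with a countable dynamical ball of positive radius around `x` has
`x` as a periodic point. -/
theorem exists_zpow_apply_eq_self [CompactSpace X] (hrec : Recurrent f) (hη : 0 < η)
    (hc : (dynBall f η x).Countable) : ∃ n : ℤ, n ≠ 0 ∧ (f ^ n) x = x := by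
  -- The slack `r < η` keeps `T` stable under powers of `f` close to the identity.
  let T : Set X := {y | ∃ n : ℤ, ∃ r < η, (∀ w, dist w ((f ^ n) w) ≤ r) ∧ y = (f ^ n) x}
  have hT : closure T ⊆ dynBall f η x := by
    refine closure_minimal ?_ (isClosed_dynBall f η x)
    rintro _ ⟨n, r, hr, h, rfl⟩
    exact zpow_apply_mem_dynBall fun w => (h w).trans hr.le
  have hne : T.Nonempty := ⟨x, 0, 0, hη, by simp, by simp⟩
  obtain ⟨z, ⟨n, r, hr, h, rfl⟩, U, hU, hUT⟩ :=
    exists_isOpen_inter_closure_eq_singleton hne (hc.mono hT)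
  obtain ⟨ε, hε, hball⟩ := Metric.isOpen_iff.1 hU _ (hUT.ge rfl).1
  obtain ⟨m, hm, hmε⟩ := hrec (min ε (η - r)) (lt_min hε (sub_pos.2 hr))
  have hmT : (f ^ m) ((f ^ n) x) ∈ T := by
    obtain ⟨s, hs, hms⟩ : ∃ s < η - r, ∀ w, dist w ((f ^ m) w) ≤ s := by
      have : Nonempty X := ⟨x⟩
      obtain ⟨w, -, hw⟩ := isCompact_univ.exists_isMaxOn univ_nonempty
        (continuous_id.dist (continuous_zpow f m)).continuousOn
      exact ⟨_, (hmε w).trans_le (min_le_right _ _), fun v => hw (mem_univ v)⟩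
    refine ⟨m + n, r + s, by linarith, fun w => ?_, (zpow_add_apply f m n x).symm⟩
    rw [zpow_add_apply]
    exact (dist_triangle _ _ _).trans (add_le_add (h w) (hms _))
  have hmU : (f ^ m) ((f ^ n) x) ∈ U := by
    refine hball ?_
    rw [Metric.mem_ball, dist_comm]
    exact (hmε _).trans_le (min_le_left _ _)
  have e : (f ^ m) ((f ^ n) x) = (f ^ n) x := hUT.le ⟨hmU, subset_closure hmT⟩
  refine ⟨m, hm, (f ^ n).injective ?_⟩
  rwa [← zpow_add_apply, add_comm, zpow_add_apply]

/-! ### Finite dynamical balls and isolated points -/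

theorem exists_pos_periodic_dist {y : X} (hx : ∃ n : ℤ, n ≠ 0 ∧ (f ^ n) x = x)
    (hy : ∃ n : ℤ, n ≠ 0 ∧ (f ^ n) y = y) :
    ∃ n : ℤ, 0 < n ∧ Function.Periodic (fun k : ℤ => dist ((f ^ k) x) ((f ^ k) y)) n := by
  obtain ⟨n, hn, hxn⟩ := exists_pos_periodic_zpow_apply hx
  obtain ⟨m, hm, hym⟩ := exists_pos_periodic_zpow_apply hy
  refine ⟨m * n, mul_pos hm hn, fun k => ?_⟩
  have e₁ := hxn.int_mul m k
  have e₂ := hym.int_mul n k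
  rw [Int.cast_id] at e₁ e₂
  rw [mul_comm] at e₂
  exact congrArg₂ dist e₁ e₂

/-- If `x` is not isolated and `Γ_δ(x)` does not accumulate at `x`, some point of some dynamical
ball `Γ_δ(x')`, with `x'` on the orbit of `x`, is at distance exactly `δ` from the centre. -/
theorem exists_mem_dynBall_dist_eq [CompactSpace X]
    (hper : ∀ y : X, ∃ n : ℤ, n ≠ 0 ∧ (f ^ n) y = y) [NeBot (𝓝[≠] x)] {δ : ℝ} (hδ : 0 < δ)
    (hx : ∀ᶠ y in 𝓝[≠] x, y ∉ dynBall f δ x) :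
    ∃ x' ∈ orbit f x, ∃ z ∈ dynBall f δ x', dist x' z = δ := by
  classical
  have hexit : ∀ y, y ∉ dynBall f δ x → ∃ k : ℕ, δ < dist ((f ^ (k : ℤ)) x) ((f ^ (k : ℤ)) y) := by
    intro y hy
    -- Periodicity moves any exit time to a nonnegative one.
    simp only [dynBall, mem_ofPred_eq, not_forall, not_le] at hy
    obtain ⟨k, hk⟩ := hy
    obtain ⟨n, hn, hp⟩ := exists_pos_periodic_dist (hper x) (hper y)
    obtain ⟨j, hj, e⟩ := hp.exists_mem_Ico₀ hn k
    lift j to ℕ using hj.1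
    exact ⟨j, hk.trans_eq e⟩
  -- `m y` is the first time at which the orbits of `x` and `y` are more than `δ` apart.
  have hfirst : ∀ y, ∃ m : ℕ, y ∉ dynBall f δ x → δ < dist ((f ^ (m : ℤ)) x) ((f ^ (m : ℤ)) y) ∧
      ∀ i < m, dist ((f ^ (i : ℤ)) x) ((f ^ (i : ℤ)) y) ≤ δ := by
    intro y
    by_cases hy : y ∈ dynBall f δ x
    · exact ⟨0, fun h => absurd hy h⟩
    · exact ⟨Nat.find (hexit y hy), fun _ => ⟨Nat.find_spec (hexit y hy),
        fun i hi => not_lt.1 (Nat.find_min (hexit y hy) hi)⟩⟩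
  choose m hm using hfirst
  let u : Ultrafilter X := Ultrafilter.of (𝓝[≠] x)
  have hu : (u : Filter X) ≤ 𝓝[≠] x := Ultrafilter.of_le _
  have hux : (u : Filter X) ≤ 𝓝 x := hu.trans nhdsWithin_le_nhds
  obtain ⟨x', -, hx'⟩ := isCompact_univ.ultrafilter_le_nhds
    (u.map fun y => (f ^ (m y : ℤ)) x) (by simp)
  obtain ⟨z, -, hz⟩ := isCompact_univ.ultrafilter_le_nhds
    (u.map fun y => (f ^ (m y : ℤ)) y) (by simp)
  have hx' : Tendsto (fun y => (f ^ (m y : ℤ)) x) u (𝓝 x') := hx'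
  have hz : Tendsto (fun y => (f ^ (m y : ℤ)) y) u (𝓝 z) := hz
  have hlarge : ∀ j : ℕ, ∀ᶠ y in (u : Filter X), j < m y := by
    intro j
    have hclose : ∀ᶠ y in (u : Filter X), ∀ i ∈ Finset.range (j + 1),
        dist ((f ^ (i : ℤ)) x) ((f ^ (i : ℤ)) y) < δ := by
      refine (Filter.eventually_all_finset _).2 fun i _ => ?_
      have hc : Continuous fun y => dist ((f ^ (i : ℤ)) x) ((f ^ (i : ℤ)) y) :=
        continuous_const.dist (continuous_zpow f i)
      exact hux ((hc.tendsto x).eventually_lt_const (by simpa using hδ))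
    filter_upwards [hclose, hu hx] with y hy hyx
    by_contra! hle
    exact ((hm y hyx).1.trans (hy _ (Finset.mem_range.2 (by omega)))).false
  -- Times `m y + j` with `j < 0` precede the first exit, and `m y → ∞` makes them nonnegative.
  have hback : ∀ j : ℤ, j < 0 → dist ((f ^ j) x') ((f ^ j) z) ≤ δ := by
    intro j hj
    refine le_of_tendsto ((((continuous_zpow f j).tendsto x').comp hx').dist
      (((continuous_zpow f j).tendsto z).comp hz)) ?_
    filter_upwards [hlarge j.natAbs, hu hx] with y hy hyx
    have e : j + m y = ((m y - j.natAbs : ℕ) : ℤ) := by omega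
    simp only [Function.comp_apply, ← zpow_add_apply, e]
    exact (hm y hyx).2 _ (by omega)
  -- By periodicity, every time has the same distance as some negative time.
  have hzmem : z ∈ dynBall f δ x' := by
    intro k
    obtain ⟨n, hn, hp⟩ := exists_pos_periodic_dist (hper x') (hper z)
    obtain ⟨j, hj, e⟩ := hp.exists_mem_Ico hn k (-n)
    exact e.trans_le (hback j (by have := hj.2; omega))
  refine ⟨x', ?_, z, hzmem, le_antisymm (by simpa using hzmem 0) ?_⟩
  · exact (finite_orbit (hper x)).isClosed.mem_of_tendsto hx'
      (Eventually.of_forall fun y => ⟨_, rfl⟩)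
  · refine ge_of_tendsto (hx'.dist hz) ?_
    filter_upwards [hu hx] with y hyx using (hm y hyx).1.le

theorem isOpen_singleton_of_periodic [CompactSpace X]
    (hper : ∀ y : X, ∃ n : ℤ, n ≠ 0 ∧ (f ^ n) y = y) (hη : 0 < η)
    (hfin : ∀ y : X, (dynBall f η y).Finite) (x : X) : IsOpen ({x} : Set X) := by
  by_contra hx
  have : NeBot (𝓝[≠] x) := ⟨fun h => hx (isOpen_singleton_iff_punctured_nhds x |>.2 h)⟩
  have hD : (⋃ x' ∈ orbit f x, dist x' '' dynBall f η x').Finite :=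
    (finite_orbit (hper x)).biUnion fun x' _ => (hfin x').image _
  obtain ⟨δ, hδ, hδD⟩ := (Ioc_infinite hη).exists_notMem_finite hD
  have hacc : ∀ᶠ y in 𝓝[≠] x, y ∉ dynBall f δ x := by
    have h : ∀ᶠ y in 𝓝 x, y ∉ dynBall f η x \ {x} :=
      ((hfin x).subset sdiff_subset).isClosed.isOpen_compl.mem_nhds (by simp)
    filter_upwards [nhdsWithin_le_nhds h, self_mem_nhdsWithin] with y hy hyx hyδ
    exact hy ⟨dynBall_mono hδ.2 hyδ, hyx⟩
  obtain ⟨x', hx', z, hz, e⟩ := exists_mem_dynBall_dist_eq hper hδ.1 hacc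
  exact hδD (mem_iUnion₂.2 ⟨x', hx', z, dynBall_mono hδ.2 hz, e⟩)

theorem finite_of_periodic [CompactSpace X]
    (hper : ∀ y : X, ∃ n : ℤ, n ≠ 0 ∧ (f ^ n) y = y) (hf : FiniteExpansive f) : Finite X := by
  obtain ⟨η, hη, hfin⟩ := hf
  have : DiscreteTopology X :=
    discreteTopology_iff_isOpen_singleton.2 (isOpen_singleton_of_periodic hper hη hfin)
  exact finite_of_compact_of_discrete

theorem dynBall_subset_orbit
    (h : ∀ x y : X, y ∉ orbit f x → ∃ n : ℤ, η < dist ((f ^ n) x) ((f ^ n) y)) (x : X) :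
    dynBall f η x ⊆ orbit f x := by
  intro y hy
  by_contra hn
  obtain ⟨n, hn⟩ := h x y hn
  exact (hy n).not_gt hn

end Metric

end TopDyn

theorem mainTheorem4 {X : Type*} [MetricSpace X] [CompactSpace X] (f : X ≃ₜ X)
    (hrec : TopDyn.Recurrent f) (hf : TopDyn.FiniteExpansive f ∨ TopDyn.Separating f) :
    Finite X := by
  rcases hf with hf | ⟨η, hη, hsep⟩
  · obtain ⟨η, hη, hfin⟩ := id hf
    exact TopDyn.finite_of_periodic
      (fun x => TopDyn.exists_zpow_apply_eq_self hrec hη (hfin x).countable) hf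
  · have hsub := TopDyn.dynBall_subset_orbit hsep
    have hper : ∀ x : X, ∃ n : ℤ, n ≠ 0 ∧ (f ^ n) x = x := fun x =>
      TopDyn.exists_zpow_apply_eq_self hrec hη ((TopDyn.countable_orbit f x).mono (hsub x))
    exact TopDyn.finite_of_periodic hper
      ⟨η, hη, fun x => (TopDyn.finite_orbit (hper x)).subset (hsub x)⟩
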